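/- Let $k$ be a field and let $n \ge 2$. Let $T(n)$ be the nil Temperley--Lieb algebra of type affine $C$: the unital associative $k$-algebra with generators $u_0, u_1, \dots, u_n$ and defining relations $u_i^2 = 0$ for all $i$; $u_iu_j = u_ju_i$ if $|i-j|>1$; $u_iu_ju_i = 0$ if $|i-j|=1$ and $1 \le i,j \le n-1$; $u_1u_0u_1 = 0$; and $u_{n-1}u_nu_{n-1} = 0$. A Coxeter word is a word in $s_0, \dots, s_n$ in which every $s_i$ occurs exactly once, that is, a reduced expression $w$ of a Coxeter element of the Weyl group of type affine $C_n$; let $u_w$ denote the product of the corresponding generators of $T(n)$. The contour of $w$ is the string $p_1p_2\cdots p_n$ in the letters $+,-$ with $p_i = +$ if $s_{i-1}$ occurs to the right of $s_i$ in $w$, and $p_i = -$ otherwise. Let $\Lambda$ be the set of weights, i.e. of all $2^n$ strings of length $n$ in $+,-$; every weight is the contour of a Coxeter word, and $u_w$ depends only on the contour $\lambda$ of $w$, so it may be written $u_\lambda$. Put $Q = \sum_{\lambda\in\Lambda} u_\lambda \in T(n)$. Let $T(n)[Q^{-1}]$ be the $k$-algebra obtained from the presentation of $T(n)$ by adding one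 generator $Q^{-1}$ and the relations $QQ^{-1} = Q^{-1}Q = 1$. Theorem. The element $Q$ is central in $T(n)$, and its image is central in $T(n)[Q^{-1}]$; so $T(n)[Q^{-1}]$ is an algebra over the Laurent polynomial ring $k[q,q^{-1}]$, with $q$ acting as multiplication by $Q$. As a $k[q,q^{-1}]$-algebra, $T(n)[Q^{-1}]$ is isomorphic to the full matrix ring $M_{2^n}(k[q,q^{-1}])$ with rows and columns indexed by $\Lambda$. The isomorphism may be chosen so that $Q$ corresponds to $q$ times the identity matrix and, for each weight $\lambda$, $u_\lambda$ corresponds to $q$ times the diagonal matrix unit $E_{\lambda,\lambda}$. -/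

import Mathlib

open scoped LaurentPolynomial

namespace NilTL

/-- The defining relations of the nil Temperley--Lieb algebra of type affine `C`, imposed on a
family `u 0, …, u n` of elements of a ring. -/
inductive Rel {n : ℕ} {A : Type*} [Semiring A] (u : Fin (n + 1) → A) : A → A → Prop
  | sq (i : Fin (n + 1)) : Rel u (u i * u i) 0
  | comm (i j : Fin (n + 1)) (h : i.val + 1 < j.val ∨ j.val + 1 < i.val) :
      Rel u (u i * u j) (u j * u i)
  | braid (i j : Fin (n + 1)) (h : i.val + 1 = j.val ∨ j.val + 1 = i.val)
      (hi : 1 ≤ i.val) (hi' : i.val + 1 ≤ n) (hj : 1 ≤ j.val) (hj' : j.val + 1 ≤ n) :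
      Rel u (u i * u j * u i) 0
  | left (i j : Fin (n + 1)) (hi : i.val = 1) (hj : j.val = 0) : Rel u (u i * u j * u i) 0
  | right (i j : Fin (n + 1)) (hi : i.val + 1 = n) (hj : j.val = n) : Rel u (u i * u j * u i) 0

/-- Weights: strings of length `n` in the letters `+` (`true`) and `-` (`false`). The letter
`p_{i+1}` of the string `p_1 ⋯ p_n` is the value at `i : Fin n`. -/
abbrev Weight (n : ℕ) : Type := Fin n → Bool

theorem card_weight (n : ℕ) : Fintype.card (Weight n) = 2 ^ n := by simp

/-- Words that use every generator `s_0, …, s_n` exactly once, i.e. the reduced expressions of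
Coxeter elements. -/
def IsCoxeterWord {n : ℕ} (w : List (Fin (n + 1))) : Prop :=
  w.Nodup ∧ ∀ i, i ∈ w

/-- The contour of (the Coxeter element with expression) `w`: its `i`-th letter is `+` if
`s_{i-1}` occurs to the right of `s_i` in `w`, and `-` otherwise. -/
def contour {n : ℕ} (w : List (Fin (n + 1))) : Weight n :=
  fun i => decide (w.idxOf i.succ < w.idxOf i.castSucc)

/-- An expression of the Coxeter element `w(lam)` whose contour is `lam`: the generators are
inserted in the order `s_0, s_1, …, s_n`, with `s_i` placed at the left end if the `i`-th letter
is `+` and at the right end if it is `-`. -/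
def coxeterWord : (n : ℕ) → Weight n → List (Fin (n + 1))
  | 0, _ => [0]
  | n + 1, lam =>
    let w := (coxeterWord n fun i => lam i.castSucc).map Fin.castSucc
    if lam (Fin.last n) then Fin.last (n + 1) :: w else w ++ [Fin.last (n + 1)]

/-- The value `u_{i_1} ⋯ u_{i_r}` of the word `s_{i_1} ⋯ s_{i_r}`. -/
def wordProd {n : ℕ} {A : Type*} [Monoid A] (u : Fin (n + 1) → A) (w : List (Fin (n + 1))) : A :=
  (w.map u).prod

/-- `Q`, the sum over all weights `lam` of `u_lam = u_{w(lam)}`. -/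
def qSum {n : ℕ} {A : Type*} [Semiring A] (u : Fin (n + 1) → A) : A :=
  ∑ lam : Weight n, wordProd u (coxeterWord n lam)

/-! The word chosen for a weight is a Coxeter word with that contour, and the value of a Coxeter
word depends only on its contour. -/

theorem mem_coxeterWord : ∀ (n : ℕ) (lam : Weight n) (i : Fin (n + 1)), i ∈ coxeterWord n lam
  | 0, _, i => by simp [coxeterWord, Fin.fin_one_eq_zero i]
  | n + 1, lam, i => by
    have ih := mem_coxeterWord n fun i => lam i.castSucc
    induction i using Fin.lastCases with
    | last => unfold coxeterWord; dsimp only; split <;> simp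
    | cast i => unfold coxeterWord; dsimp only; split <;> simp [ih i]

theorem nodup_coxeterWord : ∀ (n : ℕ) (lam : Weight n), (coxeterWord n lam).Nodup
  | 0, _ => by simp [coxeterWord]
  | n + 1, lam => by
    have ih := (nodup_coxeterWord n fun i => lam i.castSucc).map (Fin.castSucc_injective (n + 1))
    unfold coxeterWord; dsimp only; split
    · simpa [List.nodup_cons] using ih
    · refine List.Nodup.append ih (by simp) ?_
      simp

theorem isCoxeterWord_coxeterWord {n : ℕ} (lam : Weight n) : IsCoxeterWord (coxeterWord n lam) :=
  ⟨nodup_coxeterWord n lam, mem_coxeterWord n lam⟩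

theorem idxOf_map_castSucc {n : ℕ} (w : List (Fin n)) (i : Fin n) :
    (w.map Fin.castSucc).idxOf i.castSucc = w.idxOf i := by
  induction w with
  | nil => simp
  | cons a w ihw =>
    by_cases h : a = i
    · simp [h]
    · rw [List.map_cons, List.idxOf_cons_ne _ h, List.idxOf_cons_ne _ (by simpa using h), ihw]

theorem contour_coxeterWord : ∀ {n : ℕ} (lam : Weight n), contour (coxeterWord n lam) = lam
  | 0, lam => by funext i; exact i.elim0
  | n + 1, lam => by
    have ih := contour_coxeterWord (fun i => lam i.castSucc)
    have hmem : ∀ i : Fin (n + 1), i.castSucc ∈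
        (coxeterWord n fun i => lam i.castSucc).map Fin.castSucc :=
      fun i => List.mem_map_of_mem (mem_coxeterWord n _ i)
    funext i
    induction i using Fin.lastCases with
    | last =>
      unfold coxeterWord contour; dsimp only; rw [Fin.succ_last]; split
      · rename_i h
        rw [List.idxOf_cons_self, List.idxOf_cons_ne _ (Fin.castSucc_ne_last _).symm, h]
        simp
      · rename_i h
        rw [List.idxOf_append_of_mem (hmem _), List.idxOf_append_of_notMem (by simp)]
        simp only [Bool.not_eq_true] at h
        rw [h, decide_eq_false_iff_not, not_lt]
        have := List.idxOf_lt_length_iff.2 (hmem (Fin.last n))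
        omega
    | cast i =>
      have h := congrFun ih i
      unfold contour at h
      unfold coxeterWord contour; dsimp only; rw [Fin.succ_castSucc]; split
      · rw [List.idxOf_cons_ne _ (Fin.castSucc_ne_last _).symm,
          List.idxOf_cons_ne _ (Fin.castSucc_ne_last _).symm, idxOf_map_castSucc,
          idxOf_map_castSucc, ← h]
        simp
      · rw [List.idxOf_append_of_mem (hmem _), List.idxOf_append_of_mem (hmem _),
          idxOf_map_castSucc, idxOf_map_castSucc]
        exact h

theorem commute_wordProd {n : ℕ} {A : Type*} [Monoid A] (u : Fin (n + 1) → A) (x : A)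
    (l : List (Fin (n + 1))) (h : ∀ i ∈ l, Commute x (u i)) : Commute x (wordProd u l) := by
  refine Commute.list_prod_right _ _ ?_
  simpa using h

theorem wordProd_eq_coxeterWord {A : Type*} [Monoid A] : ∀ {n : ℕ} (u : Fin (n + 1) → A)
    (_ : ∀ i j : Fin (n + 1), i.val + 1 < j.val → u i * u j = u j * u i)
    (w : List (Fin (n + 1))) (_ : IsCoxeterWord w),
    wordProd u w = wordProd u (coxeterWord n (contour w))
  | 0, u, _, w, hw => by
    have h : w = [0] := by
      match w, hw with
      | [], hw => exact absurd (hw.2 0) (by simp)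
      | [a], _ => rw [Fin.fin_one_eq_zero a]
      | a :: b :: l, hw =>
        have := hw.1
        rw [Fin.fin_one_eq_zero a, Fin.fin_one_eq_zero b] at this
        simp at this
    rw [h, coxeterWord]
  | n + 1, u, hu, w, hw => by
    obtain ⟨l, r, rfl⟩ := List.append_of_mem (hw.2 (Fin.last (n + 1)))
    obtain ⟨hnd, hall⟩ := hw
    have hmid := List.nodup_middle.1 hnd
    rw [List.nodup_cons] at hmid
    have hlast : ∀ i ∈ l ++ r, i ≠ Fin.last (n + 1) := fun i hi e => hmid.1 (e ▸ hi)
    obtain ⟨v, hv⟩ : ∃ v : List (Fin (n + 1)), v.map Fin.castSucc = l ++ r := by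
      refine ⟨(l ++ r).pmap (fun i h => Fin.castPred i h) hlast, ?_⟩
      rw [List.map_pmap]
      simp
    have hvmem : ∀ i : Fin (n + 1), i.castSucc ∈ l ++ r := fun i => by
      have := hall i.castSucc
      simpa [Fin.castSucc_ne_last] using this
    have hvc : IsCoxeterWord v := by
      refine ⟨List.Nodup.of_map Fin.castSucc (hv ▸ hmid.2), fun i => ?_⟩
      have := hvmem i
      rw [← hv] at this
      simpa using this
    have hlr : l.Disjoint r := (List.nodup_append'.1 hmid.2).2.2
    have hidx : ∀ i : Fin (n + 1), (l ++ Fin.last (n + 1) :: r).idxOf i.castSucc =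
        if i.castSucc ∈ l then v.idxOf i else v.idxOf i + 1 := fun i => by
      rw [← idxOf_map_castSucc v, hv]
      split
      · rename_i h
        rw [List.idxOf_append_of_mem h, List.idxOf_append_of_mem h]
      · rename_i h
        rw [List.idxOf_append_of_notMem h, List.idxOf_append_of_notMem h,
          List.idxOf_cons_ne _ (Fin.castSucc_ne_last _).symm]
        omega
    have hidxl : ∀ i : Fin (n + 1), i.castSucc ∈ l ↔ v.idxOf i < l.length := fun i => by
      rw [← idxOf_map_castSucc v, hv]
      constructor
      · intro h
        rw [List.idxOf_append_of_mem h]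
        exact List.idxOf_lt_length_iff.2 h
      · intro h
        by_contra h'
        rw [List.idxOf_append_of_notMem h'] at h
        omega
    have hlastl : Fin.last (n + 1) ∉ l := fun h => hmid.1 (List.mem_append_left _ h)
    have hcv : contour v = fun i => contour (l ++ Fin.last (n + 1) :: r) i.castSucc := by
      funext i
      unfold contour
      rw [Fin.succ_castSucc, hidx, hidx]
      have h1 := hidxl i.succ
      have h2 := hidxl i.castSucc
      refine decide_eq_decide.2 ?_
      have h3 : v.idxOf i.succ ≠ v.idxOf i.castSucc := fun h => by
        have := (List.idxOf_inj (hvc.2 i.succ)).1 h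
        simp [Fin.ext_iff] at this
      split <;> split <;> grind
    have hcl : contour (l ++ Fin.last (n + 1) :: r) (Fin.last n) =
        decide ((Fin.last n).castSucc ∉ l) := by
      unfold contour
      rw [Fin.succ_last, hidx, List.idxOf_append_of_notMem hlastl, List.idxOf_cons_self]
      have := hidxl (Fin.last n)
      refine decide_eq_decide.2 ?_
      split <;> grind
    have ih := wordProd_eq_coxeterWord (fun i => u i.castSucc)
      (fun i j h => hu i.castSucc j.castSucc h) v hvc
    have hmapw : ∀ x : List (Fin (n + 1)),
        wordProd u (x.map Fin.castSucc) = wordProd (fun i => u i.castSucc) x := fun x => by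
      simp [wordProd, Function.comp_def]
    have happ : ∀ x y : List (Fin (n + 2)),
        wordProd u (x ++ y) = wordProd u x * wordProd u y := fun x y => by simp [wordProd]
    have hcons : ∀ (i : Fin (n + 2)) (y : List (Fin (n + 2))),
        wordProd u (i :: y) = u i * wordProd u y := fun x y => by simp [wordProd]
    have hlt : ∀ i : Fin (n + 2), i ≠ Fin.last (n + 1) → i ≠ (Fin.last n).castSucc →
        Commute (u (Fin.last (n + 1))) (u i) := fun i h1 h2 => by
      refine (hu i _ ?_).symm
      have := i.isLt
      simp only [ne_eq, Fin.ext_iff, Fin.val_last, Fin.val_castSucc] at h1 h2 ⊢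
      omega
    unfold coxeterWord
    dsimp only
    rw [← hcv, hcl, happ, hcons]
    by_cases hm : (Fin.last n).castSucc ∈ l
    · have hr : (Fin.last n).castSucc ∉ r := fun h => hlr hm h
      have hcr := commute_wordProd u (u (Fin.last (n + 1))) r fun i hi =>
        hlt i (hlast i (List.mem_append_right _ hi)) (fun e => hr (e ▸ hi))
      rw [if_neg (by simpa using hm), happ, hmapw, ← ih, ← hmapw, hv, happ, hcr.eq, hcons]
      simp [wordProd, mul_assoc]
    · have hcr := commute_wordProd u (u (Fin.last (n + 1))) l fun i hi =>
        hlt i (hlast i (List.mem_append_left _ hi)) (fun e => hm (e ▸ hi))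
      rw [if_pos (by simpa using hm), hcons, hmapw, ← ih, ← hmapw, hv, happ, ← mul_assoc,
        ← mul_assoc, hcr.eq]

variable (k : Type*) [Field k] (n : ℕ)

/-- The nil Temperley--Lieb algebra `T(n)` of type affine `C` over `k`. -/
abbrev NTL : Type _ := RingQuot (Rel (n := n) (FreeAlgebra.ι k))

/-- The generators `u_0, …, u_n` of `T(n)`. -/
noncomputable def NTL.u (i : Fin (n + 1)) : NTL k n :=
  RingQuot.mkAlgHom k _ (FreeAlgebra.ι k i)

/-- The element `Q` of `T(n)`. -/
noncomputable def NTL.Q : NTL k n := qSum (NTL.u k n)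

/-- The relations of `T(n)[Q⁻¹]` in the free algebra on `u_0, …, u_n` (the generators `some i`) and
`Q⁻¹` (the generator `none`). -/
inductive LocRel : FreeAlgebra k (Option (Fin (n + 1))) → FreeAlgebra k (Option (Fin (n + 1))) → Prop
  | base (x y) (h : Rel (fun i : Fin (n + 1) => FreeAlgebra.ι k (some i)) x y) : LocRel x y
  | mul_inv : LocRel
      (qSum (fun i : Fin (n + 1) => FreeAlgebra.ι k (some i)) * FreeAlgebra.ι k none) 1
  | inv_mul : LocRel
      (FreeAlgebra.ι k none * qSum (fun i : Fin (n + 1) => FreeAlgebra.ι k (some i))) 1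

/-- The algebra `T(n)[Q⁻¹]`: one generator `Q⁻¹` and the relations `Q Q⁻¹ = Q⁻¹ Q = 1` are added to
the presentation of `T(n)`. -/
abbrev NTLLoc : Type _ := RingQuot (LocRel k n)

/-- The images in `T(n)[Q⁻¹]` of the generators `u_0, …, u_n`. -/
noncomputable def NTLLoc.u (i : Fin (n + 1)) : NTLLoc k n :=
  RingQuot.mkAlgHom k (LocRel k n) (FreeAlgebra.ι k (some i))

theorem map_wordProd {n : ℕ} {A B F : Type*} [Monoid A] [Monoid B] [FunLike F A B]
    [MonoidHomClass F A B] (f : F) (u : Fin (n + 1) → A) (w : List (Fin (n + 1))) :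
    f (wordProd u w) = wordProd (fun i => f (u i)) w := by
  simp [wordProd, map_list_prod, Function.comp_def]

theorem map_qSum {n : ℕ} {A B F : Type*} [Semiring A] [Semiring B] [FunLike F A B]
    [RingHomClass F A B] (f : F) (u : Fin (n + 1) → A) :
    f (qSum u) = qSum (fun i => f (u i)) := by
  simp [qSum, map_wordProd]

/-- The natural homomorphism from `T(n)` to `T(n)[Q⁻¹]`. -/
noncomputable def toLoc : NTL k n →ₐ[k] NTLLoc k n :=
  RingQuot.liftAlgHom k ⟨FreeAlgebra.lift k (NTLLoc.u k n), fun x y h => by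
    have key : ∀ a b : FreeAlgebra k (Option (Fin (n + 1))),
        Rel (fun i : Fin (n + 1) => FreeAlgebra.ι k (some i)) a b →
        RingQuot.mkAlgHom k (LocRel k n) a = RingQuot.mkAlgHom k (LocRel k n) b :=
      fun a b h => RingQuot.mkAlgHom_rel k (LocRel.base a b h)
    cases h with
    | sq i => simpa [NTLLoc.u] using key _ _ (Rel.sq i)
    | comm i j h => simpa [NTLLoc.u] using key _ _ (Rel.comm i j h)
    | braid i j h a b c d => simpa [NTLLoc.u] using key _ _ (Rel.braid i j h a b c d)
    | left i j a b => simpa [NTLLoc.u] using key _ _ (Rel.left i j a b)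
    | right i j a b => simpa [NTLLoc.u] using key _ _ (Rel.right i j a b)⟩

theorem toLoc_u (i : Fin (n + 1)) : toLoc k n (NTL.u k n i) = NTLLoc.u k n i := by
  simp [toLoc, NTL.u]

/-- The element `Q` as a unit of `T(n)[Q⁻¹]`, whose inverse is the adjoined generator. -/
noncomputable def qUnit : (NTLLoc k n)ˣ where
  val := toLoc k n (NTL.Q k n)
  inv := RingQuot.mkAlgHom k (LocRel k n) (FreeAlgebra.ι k none)
  val_inv := by
    have h := RingQuot.mkAlgHom_rel k (LocRel.mul_inv (k := k) (n := n))
    simpa [NTL.Q, map_qSum, toLoc_u, NTLLoc.u] using h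
  inv_val := by
    have h := RingQuot.mkAlgHom_rel k (LocRel.inv_mul (k := k) (n := n))
    simpa [NTL.Q, map_qSum, toLoc_u, NTLLoc.u] using h

/-- The homomorphism `k[q,q⁻¹] → T(n)[Q⁻¹]` of `k`-algebras with `q ↦ Q`. -/
noncomputable def scalarHom : k[T;T⁻¹] →ₐ[k] NTLLoc k n :=
  AddMonoidAlgebra.lift k (NTLLoc k n) ℤ
    ((Units.coeHom (NTLLoc k n)).comp (zpowersHom (NTLLoc k n)ˣ (qUnit k n)))

theorem scalarHom_T : scalarHom k n (LaurentPolynomial.T 1) = toLoc k n (NTL.Q k n) := by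
  have h : (LaurentPolynomial.T 1 : k[T;T⁻¹]) = AddMonoidAlgebra.single 1 1 := rfl
  rw [h, scalarHom, AddMonoidAlgebra.lift_single]
  simp [qUnit]

end NilTL

/-!
`T(n)` acts by hopping particles on a segment with `n` sites. A weight is read as a configuration:
the letter `-` (`false`) is an occupied site and `+` (`true`) an empty one. The generator `u_i`, for
`0 < i < n`, moves a particle from the site to the left of `i` to the site to its right, `u_0` creates
a particle at the left end and `u_n` removes one at the right end. Counting removals by powers of `q`
gives a representation by matrices over `k[q,q⁻¹]` (`wordMatrix`, `satisfies_wordMatrix`). A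
Coxeter word makes each move once, so it can be carried out only from its contour, to which it returns
(`IsCoxeterWord.admissible_iff`); hence `u_lam` acts as `q E_{lam,lam}`, and `Q` acts as `q`.

In the other direction, two facts about the algebra itself are needed. A move that is not allowed in
`lam` annihilates `u_lam` (`Satisfies.mul_wordProd_eq_zero`), because a factor `u_i ^ 2` or
`u_i u_j u_i` appears after commutations. And any two sequences of allowed moves from the same
configuration that contain each generator equally often differ by commutations only
(`wordProd_eq_of_perm`), because generators commute if either of them can have made the last move
towards one and the same configuration (`distant_of_movable`). It
follows that `u_i u_lam = u_{i lam} u_i`, where `i lam` is `lam` with the letters next to `i` changed,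
so that `Q` is central (`Satisfies.mul_qSum`).

Once `Q` is invertible, the elements `e_lam = Q⁻¹ u_lam` have sum `1`, so the products of a word
with some `e_lam` span the localization over `k[q,q⁻¹]`. Such a product is `0` unless the word is a
path in the graph of configurations. By conservation of particles, two paths with the same ends contain
the generators equally often up to complete rounds (`count_add_count`), and a round amounts to a
factor `Q`; so the two products agree up to a power of `Q` (`wordProd_mul_idem_eq`). As the graph is
strongly connected (`reachable`), one product for each pair of configurations is enough to span, and
these products go to unit multiples of the matrix units. The representation is therefore an
isomorphism (`bijective_of_map_eq_wordMatrix`).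
-/

namespace NilTL

/-! ### The hopping model -/

section Combinatorics

variable {n : ℕ}

/-- The effect of `u_i` on a weight, without regard to whether the move is allowed: the letters at
the sites next to `i` are changed. -/
def flip (i : Fin (n + 1)) (lam : Weight n) : Weight n :=
  fun s => if s.castSucc = i ∨ s.succ = i then !lam s else lam s

/-- The move `i` is allowed in the configuration `lam`: the site to the left of `i`, if there is
one, is occupied (`false`), and the site to the right of `i`, if there is one, is empty (`true`). -/
def Movable (i : Fin (n + 1)) (lam : Weight n) : Prop :=
  ∀ s : Fin n, (s.succ = i → lam s = false) ∧ (s.castSucc = i → lam s = true)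

/-- The configuration reached from `lam` by the moves in `w`; as in a product of operators, the last
letter of `w` acts first. -/
def run (w : List (Fin (n + 1))) (lam : Weight n) : Weight n :=
  w.foldr flip lam

/-- All the moves in `w` are allowed when they are applied to `lam` from the last letter to the
first. -/
def Admissible : List (Fin (n + 1)) → Weight n → Prop
  | [], _ => True
  | i :: w, lam => Admissible w lam ∧ Movable i (run w lam)

/-- The generators `i` and `j` are neither equal nor neighbours, so that `u_i` and `u_j` commute. -/
def Distant (i j : Fin (n + 1)) : Prop :=
  i.val + 1 < j.val ∨ j.val + 1 < i.val

@[simp] theorem run_nil (lam : Weight n) : run [] lam = lam := rfl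

@[simp] theorem run_cons (i : Fin (n + 1)) (w : List (Fin (n + 1))) (lam : Weight n) :
    run (i :: w) lam = flip i (run w lam) := rfl

theorem run_append (v w : List (Fin (n + 1))) (lam : Weight n) :
    run (v ++ w) lam = run v (run w lam) := by
  simp [run]

@[simp] theorem admissible_nil (lam : Weight n) : Admissible [] lam := trivial

@[simp] theorem admissible_cons (i : Fin (n + 1)) (w : List (Fin (n + 1))) (lam : Weight n) :
    Admissible (i :: w) lam ↔ Admissible w lam ∧ Movable i (run w lam) := Iff.rfl

theorem admissible_append (v w : List (Fin (n + 1))) (lam : Weight n) :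
    Admissible (v ++ w) lam ↔ Admissible w lam ∧ Admissible v (run w lam) := by
  induction v with
  | nil => simp
  | cons i v ih => simp [ih, run_append, and_assoc]

@[simp] theorem flip_flip (i : Fin (n + 1)) (lam : Weight n) : flip i (flip i lam) = lam := by
  funext s
  simp only [flip]
  split <;> simp

theorem flip_comm (i j : Fin (n + 1)) (lam : Weight n) :
    flip i (flip j lam) = flip j (flip i lam) := by
  funext s
  simp only [flip]
  split <;> split <;> rfl

theorem run_perm {v w : List (Fin (n + 1))} (h : v.Perm w) (lam : Weight n) :
    run v lam = run w lam := by
  have : LeftCommutative (flip (n := n)) := ⟨flip_comm⟩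
  exact h.foldr_eq lam

theorem exists_site {i j : Fin (n + 1)} (hij : i ≠ j) (h : ¬ Distant i j) :
    ∃ s : Fin n, s.castSucc = i ∧ s.succ = j ∨ s.castSucc = j ∧ s.succ = i := by
  have hi := i.isLt
  have hj := j.isLt
  simp only [Distant, ne_eq, Fin.ext_iff] at h hij
  rcases lt_or_gt_of_ne hij with h' | h'
  · exact ⟨⟨i.val, by omega⟩, Or.inl ⟨by ext; simp, by ext; simp; omega⟩⟩
  · exact ⟨⟨j.val, by omega⟩, Or.inr ⟨by ext; simp, by ext; simp; omega⟩⟩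

theorem Distant.symm {i j : Fin (n + 1)} (h : Distant i j) : Distant j i := Or.symm h

theorem Distant.flip_apply {i j : Fin (n + 1)} (h : Distant i j) (lam : Weight n) (s : Fin n)
    (hs : s.castSucc = i ∨ s.succ = i) : flip j lam s = lam s := by
  simp only [Distant, Fin.ext_iff, Fin.val_castSucc, Fin.val_succ] at h hs
  rw [flip, if_neg]
  simp only [Fin.ext_iff, Fin.val_castSucc, Fin.val_succ]
  omega

theorem Distant.movable_flip {i j : Fin (n + 1)} (h : Distant i j) (lam : Weight n) :
    Movable i (flip j lam) ↔ Movable i lam := by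
  refine forall_congr' fun s => ?_
  have := h.flip_apply lam s
  grind

/-- Two different generators each of which can have made the last move towards the configuration
`flip j lam` have no site in common. -/
theorem distant_of_movable {i j : Fin (n + 1)} (hij : i ≠ j) {lam : Weight n}
    (hj : Movable j lam) (hi : Movable i (flip i (flip j lam))) : Distant i j := by
  by_contra h
  obtain ⟨s, hs⟩ := exists_site hij h
  have h1 := hj s
  have h2 := hi s
  simp only [flip] at h2
  grind

theorem admissible_swap {i j : Fin (n + 1)} (h : Distant i j) {w : List (Fin (n + 1))}
    {lam : Weight n} (hw : Admissible (j :: i :: w) lam) : Admissible (i :: j :: w) lam := by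
  simp only [admissible_cons, run_cons, h.movable_flip, h.symm.movable_flip] at hw ⊢
  tauto

variable {A : Type*} [Monoid A]

theorem wordProd_cons (u : Fin (n + 1) → A) (i : Fin (n + 1)) (w : List (Fin (n + 1))) :
    wordProd u (i :: w) = u i * wordProd u w := by
  simp [wordProd]

theorem wordProd_append (u : Fin (n + 1) → A) (v w : List (Fin (n + 1))) :
    wordProd u (v ++ w) = wordProd u v * wordProd u w := by
  simp [wordProd]

/-- If the configuration reached by an admissible word looks as if the move `i` had just been made,
then the last time that `i` was made it can be postponed to the end. -/
theorem admissible_pull {u : Fin (n + 1) → A} (hu : ∀ i j, Distant i j → u i * u j = u j * u i)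
    (i : Fin (n + 1)) (v w : List (Fin (n + 1))) (lam : Weight n) (hv : i ∉ v)
    (h : Admissible (v ++ i :: w) lam) (hi : Movable i (flip i (run (v ++ i :: w) lam))) :
    Admissible (i :: (v ++ w)) lam ∧
      wordProd u (v ++ i :: w) = u i * wordProd u (v ++ w) := by
  induction v with
  | nil => exact ⟨h, wordProd_cons u i w⟩
  | cons j v ih =>
    simp only [List.mem_cons, not_or] at hv
    simp only [List.cons_append] at h hi ⊢
    have hd : Distant i j := distant_of_movable hv.1 h.2 hi
    rw [run_cons, flip_comm, hd.movable_flip] at hi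
    obtain ⟨h1, h2⟩ := ih hv.2 h.1 hi
    refine ⟨admissible_swap hd ⟨h1, ?_⟩, ?_⟩
    · have hp : (i :: (v ++ w)).Perm (v ++ i :: w) := List.perm_middle.symm
      rw [run_perm hp]
      exact h.2
    · rw [wordProd_cons, h2, ← mul_assoc, ← hu i j hd, mul_assoc, wordProd_cons]

/-- The diamond property: two ways to make the same moves from the same configuration differ by
commutations only. -/
theorem wordProd_eq_of_perm {u : Fin (n + 1) → A} (hu : ∀ i j, Distant i j → u i * u j = u j * u i)
    {v w : List (Fin (n + 1))} {lam : Weight n} (hp : v.Perm w) (hv : Admissible v lam)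
    (hw : Admissible w lam) : wordProd u v = wordProd u w := by
  induction v generalizing w with
  | nil => rw [List.nil_perm.1 hp]
  | cons i v ih =>
    have hr := run_perm hp lam
    obtain ⟨a, b, rfl, hia⟩ := List.eq_append_cons_of_mem (hp.subset List.mem_cons_self)
    obtain ⟨h1, h2⟩ := admissible_pull hu i a b lam hia hw (by
      rw [← hr, run_cons, flip_flip]
      exact hv.2)
    have hp' : v.Perm (a ++ b) := (List.perm_cons i).1 (hp.trans List.perm_middle)
    rw [h2, wordProd_cons, ih hp' hv.1 h1.1]

/-! ### Coxeter words -/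

theorem idxOf_lt_idxOf_iff {α : Type*} [DecidableEq α] {i j : α} {a b : List α} (hi : i ∉ a) :
    (a ++ i :: b).idxOf j < (a ++ i :: b).idxOf i ↔ j ∈ a := by
  rw [List.idxOf_append_of_notMem hi, List.idxOf_cons_self]
  constructor
  · intro h
    by_contra hj
    rw [List.idxOf_append_of_notMem hj] at h
    omega
  · intro h
    rw [List.idxOf_append_of_mem h]
    have := List.idxOf_lt_length_iff.2 h
    omega

theorem IsCoxeterWord.perm {v w : List (Fin (n + 1))} (hv : IsCoxeterWord v) (h : v.Perm w) :
    IsCoxeterWord w :=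
  ⟨h.nodup_iff.1 hv.1, fun i => h.subset (hv.2 i)⟩

theorem IsCoxeterWord.count {w : List (Fin (n + 1))} (hw : IsCoxeterWord w) (i : Fin (n + 1)) :
    w.count i = 1 :=
  List.count_eq_one_of_mem hw.1 (hw.2 i)

theorem contour_eq_true_iff {w : List (Fin (n + 1))} (s : Fin n) :
    contour w s = true ↔ w.idxOf s.succ < w.idxOf s.castSucc := by
  simp [contour]

theorem IsCoxeterWord.contour_eq_false_iff {w : List (Fin (n + 1))} (hw : IsCoxeterWord w)
    (s : Fin n) : contour w s = false ↔ w.idxOf s.castSucc < w.idxOf s.succ := by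
  have : w.idxOf s.castSucc ≠ w.idxOf s.succ := fun h =>
    Fin.castSucc_lt_succ.ne ((List.idxOf_inj (hw.2 _)).1 h)
  simp only [contour, decide_eq_false_iff_not]
  omega

/-- The move `i` is allowed in the contour of a Coxeter word if and only if the neighbours of `i`
stand to the left of `i`. -/
theorem movable_contour_iff {a b : List (Fin (n + 1))} {i : Fin (n + 1)}
    (hw : IsCoxeterWord (a ++ i :: b)) :
    Movable i (contour (a ++ i :: b)) ↔
      ∀ s : Fin n, (s.succ = i → s.castSucc ∈ a) ∧ (s.castSucc = i → s.succ ∈ a) := by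
  have hia : i ∉ a := fun h => (List.nodup_cons.1 (List.nodup_middle.1 hw.1)).1
    (List.mem_append_left _ h)
  refine forall_congr' fun s => and_congr ?_ ?_
  · refine imp_congr_right ?_
    rintro rfl
    rw [hw.contour_eq_false_iff, idxOf_lt_idxOf_iff hia]
  · refine imp_congr_right ?_
    rintro rfl
    rw [contour_eq_true_iff, idxOf_lt_idxOf_iff hia]

theorem contour_rotate {i : Fin (n + 1)} {a : List (Fin (n + 1))}
    (hw : IsCoxeterWord (a ++ [i])) : contour (i :: a) = flip i (contour (a ++ [i])) := by
  have hia : i ∉ a := fun h => (List.nodup_cons.1 (List.nodup_middle.1 hw.1)).1 (by simpa using h)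
  have hmem : ∀ j, j ≠ i → j ∈ a := fun j hj => by
    have := hw.2 j
    simpa [hj] using this
  have hidx : ∀ j, j ≠ i → (a ++ [i]).idxOf j < (a ++ [i]).idxOf i := fun j hj =>
    (idxOf_lt_idxOf_iff hia).2 (hmem j hj)
  have hidx' : ∀ j, j ≠ i → (i :: a).idxOf j = (a ++ [i]).idxOf j + 1 := fun j hj => by
    rw [List.idxOf_cons_ne _ hj.symm, List.idxOf_append_of_mem (hmem j hj)]
  have h0 : (i :: a).idxOf i = 0 := List.idxOf_cons_self
  funext s
  have hs : s.castSucc ≠ s.succ := Fin.castSucc_lt_succ.ne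
  simp only [flip, contour]
  by_cases h1 : s.castSucc = i
  · have h2 : s.succ ≠ i := fun h => hs (h1.trans h.symm)
    have := hidx _ h2
    simp [h1, h0, this]
  · by_cases h2 : s.succ = i
    · have := hidx _ h1
      simp [h2, h0, hidx' _ h1, this.le]
    · simp [h1, h2, hidx' _ h1, hidx' _ h2]

theorem movable_contour_concat {i : Fin (n + 1)} {a : List (Fin (n + 1))}
    (hw : IsCoxeterWord (a ++ [i])) : Movable i (contour (a ++ [i])) := by
  rw [movable_contour_iff hw]
  have hmem : ∀ j, j ≠ i → j ∈ a := fun j hj => by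
    have := hw.2 j
    simpa [hj] using this
  refine fun s => ⟨?_, ?_⟩
  · rintro rfl
    exact hmem _ Fin.castSucc_lt_succ.ne
  · rintro rfl
    exact hmem _ Fin.castSucc_lt_succ.ne'

/-- The moves of a final segment of a Coxeter word, applied to its contour, are allowed, and have the
same effect on the contour as the rotation of that segment to the front. -/
theorem admissible_contour (a b : List (Fin (n + 1))) (hw : IsCoxeterWord (a ++ b)) :
    Admissible b (contour (a ++ b)) ∧ run b (contour (a ++ b)) = contour (b ++ a) := by
  induction b generalizing a with
  | nil => simp
  | cons i b ih =>
    have e : a ++ i :: b = (a ++ [i]) ++ b := by simp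
    have hw' : IsCoxeterWord ((b ++ a) ++ [i]) := hw.perm (by
      rw [e, List.append_assoc b]
      exact List.perm_append_comm)
    obtain ⟨h1, h2⟩ := ih (a ++ [i]) (e ▸ hw)
    rw [← e] at h1 h2
    rw [← List.append_assoc] at h2
    rw [admissible_cons, run_cons, h2]
    exact ⟨⟨h1, movable_contour_concat hw'⟩, (contour_rotate hw').symm⟩

theorem IsCoxeterWord.admissible {w : List (Fin (n + 1))} (hw : IsCoxeterWord w) :
    Admissible w (contour w) :=
  (admissible_contour [] w hw).1

theorem IsCoxeterWord.run {w : List (Fin (n + 1))} (hw : IsCoxeterWord w) :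
    run w (contour w) = contour w := by
  simpa using (admissible_contour [] w hw).2

theorem run_apply_of_notMem {w : List (Fin (n + 1))} {s : Fin n} (h1 : s.castSucc ∉ w)
    (h2 : s.succ ∉ w) (lam : Weight n) : run w lam s = lam s := by
  induction w with
  | nil => rfl
  | cons i w ih =>
    simp only [List.mem_cons, not_or] at h1 h2
    rw [run_cons, flip, if_neg (by tauto), ih h1.2 h2.2]

theorem IsCoxeterWord.admissible_iff {w : List (Fin (n + 1))} (hw : IsCoxeterWord w)
    (lam : Weight n) : Admissible w lam ↔ lam = contour w := by
  refine ⟨fun h => funext fun s => ?_, fun h => h ▸ hw.admissible⟩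
  -- Of the two generators next to the site `s`, the one further to the right acts first.
  have key : ∀ i j : Fin (n + 1), w.idxOf i < w.idxOf j →
      ∃ b : List (Fin (n + 1)), i ∉ b ∧ j ∉ b ∧ Movable j (NilTL.run b lam) := fun i j hij => by
    obtain ⟨a, b, rfl, hja⟩ := List.eq_append_cons_of_mem (hw.2 j)
    have hnd := hw.1
    have hia := (idxOf_lt_idxOf_iff hja).1 hij
    rw [List.nodup_middle, List.nodup_cons, List.nodup_append'] at hnd
    refine ⟨b, hnd.2.2.2 hia, fun h => hnd.1 (List.mem_append_right _ h), ?_⟩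
    exact ((admissible_append _ _ _).1 h).1.2
  cases hs : contour w s with
  | true =>
    obtain ⟨b, hb, hb', hm⟩ := key _ _ ((contour_eq_true_iff s).1 hs)
    rw [← run_apply_of_notMem hb' hb lam]
    exact (hm s).2 rfl
  | false =>
    obtain ⟨b, hb, hb', hm⟩ := key _ _ ((hw.contour_eq_false_iff s).1 hs)
    rw [← run_apply_of_notMem hb hb' lam]
    exact (hm s).1 rfl

theorem IsCoxeterWord.contour_reverse {w : List (Fin (n + 1))} (hw : IsCoxeterWord w) :
    contour w.reverse = fun s => !contour w s := by
  funext s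
  obtain ⟨a, b, rfl, h⟩ := List.eq_append_cons_of_mem (hw.2 s.castSucc)
  have hnd := hw.1
  rw [List.nodup_middle, List.nodup_cons, List.nodup_append'] at hnd
  have e : (a ++ s.castSucc :: b).reverse = b.reverse ++ s.castSucc :: a.reverse := by simp
  have hb : s.castSucc ∉ b.reverse := by simp_all
  have hs := hw.2 s.succ
  have hs' : s.succ ≠ s.castSucc := Fin.castSucc_lt_succ.ne'
  rw [Bool.eq_iff_iff, Bool.not_eq_true', Bool.eq_false_iff, ne_eq, contour_eq_true_iff,
    contour_eq_true_iff, e, idxOf_lt_idxOf_iff hb, idxOf_lt_idxOf_iff h, List.mem_reverse]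
  simp only [List.mem_append, List.mem_cons, hs', false_or] at hs
  have : s.succ ∈ a → s.succ ∉ b := fun hs => hnd.2.2.2 hs
  tauto

end Combinatorics

/-! ### Consequences of the relations -/

section Relations

variable {n : ℕ} {A : Type*}

/-- The family `u` in the semiring `A` satisfies the relations of the nil Temperley--Lieb algebra. -/
def Satisfies [Semiring A] (u : Fin (n + 1) → A) : Prop :=
  ∀ x y, Rel u x y → x = y

theorem satisfies_map_iff {B : Type*} [Semiring A] [Semiring B] (f : A →+* B)
    (u : Fin (n + 1) → A) :
    Satisfies (fun i => f (u i)) ↔ ∀ x y, Rel u x y → f x = f y := by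
  constructor
  · intro h x y hxy
    cases hxy with
    | sq i => simpa using h _ _ (.sq i)
    | comm i j hij => simpa using h _ _ (.comm i j hij)
    | braid i j hij a b c d => simpa using h _ _ (.braid i j hij a b c d)
    | left i j a b => simpa using h _ _ (.left i j a b)
    | right i j a b => simpa using h _ _ (.right i j a b)
  · intro h x y hxy
    cases hxy with
    | sq i => simpa using h _ _ (.sq i)
    | comm i j hij => simpa using h _ _ (.comm i j hij)
    | braid i j hij a b c d => simpa using h _ _ (.braid i j hij a b c d)
    | left i j a b => simpa using h _ _ (.left i j a b)
    | right i j a b => simpa using h _ _ (.right i j a b)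

theorem Satisfies.op [Semiring A] {u : Fin (n + 1) → A} (h : Satisfies u) :
    Satisfies fun i => MulOpposite.op (u i) := by
  intro x y hxy
  apply MulOpposite.unop_injective
  cases hxy with
  | sq i => exact h _ _ (.sq i)
  | comm i j hij => exact (h _ _ (.comm i j hij)).symm
  | braid i j hij a b c d => simpa [mul_assoc] using h _ _ (.braid i j hij a b c d)
  | left i j a b => simpa [mul_assoc] using h _ _ (.left i j a b)
  | right i j a b => simpa [mul_assoc] using h _ _ (.right i j a b)

variable [Semiring A] {u : Fin (n + 1) → A}

theorem Satisfies.comm (h : Satisfies u) (i j : Fin (n + 1)) (hij : Distant i j) : u i * u j = u j * u i :=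
  h _ _ (.comm i j hij)

/-- An inner generator `i` satisfies `u_i u_j u_i = 0` for each of its two neighbours `j`. -/
theorem Satisfies.braid (h : Satisfies u) {i j : Fin (n + 1)} (hi : 1 ≤ i.val) (hi' : i.val + 1 ≤ n)
    (hij : i ≠ j) (hd : ¬ Distant i j) : u i * u j * u i = 0 := by
  have hj := j.isLt
  simp only [Distant, ne_eq, Fin.ext_iff] at hij hd
  by_cases h0 : j.val = 0
  · exact h _ _ (.left i j (by omega) h0)
  by_cases h1 : j.val = n
  · exact h _ _ (.right i j (by omega) h1)
  exact h _ _ (.braid i j (by omega) hi hi' (by omega) (by omega))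

theorem Satisfies.commute_wordProd (h : Satisfies u) {i : Fin (n + 1)} {a : List (Fin (n + 1))}
    (ha : ∀ j ∈ a, Distant i j) : u i * wordProd u a = wordProd u a * u i :=
  NilTL.commute_wordProd u (u i) a fun j hj => h.comm i j (ha j hj)

/-- A generator annihilates the value of a Coxeter word whose contour it does not move: if no
neighbour of `i` stands to the left of `i`, a factor `u_i ^ 2` can be formed, and otherwise there are
two neighbours, only one of which stands to the left of `i`, and a factor `u_i u_j u_i` can be
formed. -/
theorem Satisfies.mul_wordProd_eq_zero (h : Satisfies u) {w : List (Fin (n + 1))} (hw : IsCoxeterWord w)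
    {i : Fin (n + 1)} (hi : ¬ Movable i (contour w)) : u i * wordProd u w = 0 := by
  obtain ⟨a, b, rfl, hia⟩ := List.eq_append_cons_of_mem (hw.2 i)
  rw [movable_contour_iff hw] at hi
  by_cases ha : ∀ j ∈ a, Distant i j
  · rw [wordProd_append, wordProd_cons, ← mul_assoc, h.commute_wordProd ha, mul_assoc,
      ← mul_assoc (u i), h _ _ (.sq i), zero_mul, mul_zero]
  · push Not at ha
    obtain ⟨j, hja, hd⟩ := ha
    have hij : i ≠ j := fun e => hia (e ▸ hja)
    -- The move `i` is not allowed, so some neighbour of `i` is missing from `a`; as `j` is another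
    -- one, `i` is an inner generator and `j` is its only neighbour in `a`.
    have hnb : 1 ≤ i.val ∧ i.val + 1 ≤ n ∧ ∀ l ∈ a, l ≠ j → Distant i l := by
      simp only [Fin.forall_iff, Fin.succ_mk, Fin.castSucc_mk] at hi
      push Not at hi
      obtain ⟨s, hs, hi⟩ := hi
      have hjl := j.isLt
      have hil := i.isLt
      have hij' : i.val ≠ j.val := fun e => hij (Fin.ext e)
      have hmem : ∀ (m : ℕ) (hm : m < n + 1) (l : Fin (n + 1)), l.val = m → l ∈ a → ⟨m, hm⟩ ∈ a := by
        rintro m hm l rfl hl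
        exact hl
      have main : ∃ m, m ≤ n ∧ (m + 1 = i.val ∨ i.val + 1 = m) ∧ ∀ l ∈ a, l.val ≠ m := by
        by_cases hc : s + 1 = i.val ∧ ∀ l ∈ a, l.val ≠ s
        · exact ⟨s, by omega, by omega, hc.2⟩
        · have h1 : (⟨s + 1, by omega⟩ : Fin (n + 1)) = i → (⟨s, by omega⟩ : Fin (n + 1)) ∈ a := by
            intro e
            by_contra hsa
            refine hc ⟨by simp [← e], fun l hl e' => hsa (hmem _ _ l e' hl)⟩
          obtain ⟨e, hsa⟩ := hi h1
          refine ⟨s + 1, by omega, Or.inr (by simp [← e]), fun l hl e' => hsa (hmem _ _ l e' hl)⟩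
      obtain ⟨m, hmn, hm, hma⟩ := main
      have hjm := hma j hja
      simp only [Distant] at hd
      refine ⟨by omega, by omega, fun l hl hlj => ?_⟩
      have hlm := hma l hl
      have hlj' : l.val ≠ j.val := fun e => hlj (Fin.ext e)
      have hli : l.val ≠ i.val := fun e => hia (Fin.ext e ▸ hl)
      simp only [Distant]
      omega
    obtain ⟨hi1, hi2, hl⟩ := hnb
    obtain ⟨c, d, rfl, hjc⟩ := List.eq_append_cons_of_mem hja
    have hjd : j ∉ d := by
      have := hw.1
      rw [List.append_assoc, List.cons_append, List.nodup_middle, List.nodup_cons] at this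
      simp_all
    have hc : ∀ l ∈ c, Distant i l := fun l hlc =>
      hl l (by simp [hlc]) fun e => hjc (e ▸ hlc)
    have hdd : ∀ l ∈ d, Distant i l := fun l hlc =>
      hl l (by simp [hlc]) fun e => hjd (e ▸ hlc)
    calc u i * wordProd u (c ++ j :: d ++ i :: b)
        = u i * wordProd u c * u j * wordProd u d * u i * wordProd u b := by
          simp only [wordProd_append, wordProd_cons, mul_assoc]
      _ = wordProd u c * (u i * u j) * (wordProd u d * u i) * wordProd u b := by
          rw [h.commute_wordProd hc]
          simp only [mul_assoc]
      _ = wordProd u c * (u i * u j * u i) * wordProd u d * wordProd u b := by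
          rw [← h.commute_wordProd hdd]
          simp only [mul_assoc]
      _ = 0 := by rw [h.braid hi1 hi2 hij hd]; simp

/-- The mirror image of `mul_wordProd_eq_zero`, obtained from it in the opposite algebra. -/
theorem Satisfies.wordProd_mul_eq_zero (h : Satisfies u) {w : List (Fin (n + 1))} (hw : IsCoxeterWord w)
    {i : Fin (n + 1)} (hi : ¬ Movable i (flip i (contour w))) : wordProd u w * u i = 0 := by
  have hm : ¬ Movable i (contour w.reverse) := by
    rw [hw.contour_reverse]
    refine fun hm => hi fun s => ?_
    have := hm s
    simp only [flip]
    grind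
  have key := h.op.mul_wordProd_eq_zero (hw.perm (List.reverse_perm w).symm) hm
  have hrev : wordProd (fun i => MulOpposite.op (u i)) w.reverse = MulOpposite.op (wordProd u w) := by
    simp [wordProd, MulOpposite.op_list_prod, Function.comp_def]
  rw [hrev, ← MulOpposite.op_mul] at key
  exact MulOpposite.op_injective key

/-- Moving a generator past `u_lam` changes the weight. -/
theorem Satisfies.mul_coxeterWord (h : Satisfies u) (i : Fin (n + 1)) (lam : Weight n) :
    u i * wordProd u (coxeterWord n lam) = wordProd u (coxeterWord n (flip i lam)) * u i := by
  have hw := isCoxeterWord_coxeterWord lam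
  have hw' := isCoxeterWord_coxeterWord (flip i lam)
  by_cases hi : Movable i lam
  · have e : wordProd u (coxeterWord n (flip i lam) ++ [i]) =
        wordProd u (coxeterWord n (flip i lam)) * u i := by
      simp [wordProd]
    rw [← wordProd_cons, ← e]
    refine wordProd_eq_of_perm h.comm (lam := lam) ?_ ?_ ?_
    · refine List.Perm.trans ?_ List.perm_append_comm
      exact List.Perm.cons i ((List.perm_ext_iff_of_nodup hw.1 hw'.1).2 fun j => by
        simp [hw.2 j, hw'.2 j])
    · have h1 := hw.admissible
      have h2 := hw.run
      rw [contour_coxeterWord] at h1 h2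
      rw [admissible_cons, h2]
      exact ⟨h1, hi⟩
    · have h1 := hw'.admissible
      rw [contour_coxeterWord] at h1
      rw [admissible_append]
      exact ⟨⟨trivial, hi⟩, h1⟩
  · rw [h.mul_wordProd_eq_zero hw (by rwa [contour_coxeterWord]),
      h.wordProd_mul_eq_zero hw' (by rwa [contour_coxeterWord, flip_flip])]

theorem Satisfies.mul_qSum (h : Satisfies u) (i : Fin (n + 1)) : u i * qSum u = qSum u * u i := by
  have hinv : Function.Involutive (flip i) := flip_flip i
  rw [qSum, Finset.mul_sum, Finset.sum_mul,
    ← Equiv.sum_comp (hinv.toPerm (flip i))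
      fun lam : Weight n => wordProd u (coxeterWord n lam) * u i]
  exact Finset.sum_congr rfl fun lam _ => h.mul_coxeterWord i lam

theorem Satisfies.wordProd_mul_coxeterWord (h : Satisfies u) (w : List (Fin (n + 1))) (lam : Weight n) :
    wordProd u w * wordProd u (coxeterWord n lam) =
      wordProd u (coxeterWord n (run w lam)) * wordProd u w := by
  induction w with
  | nil => simp [wordProd]
  | cons i w ih =>
    rw [wordProd_cons, mul_assoc, ih, ← mul_assoc, h.mul_coxeterWord, mul_assoc, run_cons]

theorem Satisfies.wordProd_mul_coxeterWord_eq_zero (h : Satisfies u) {w : List (Fin (n + 1))} {lam : Weight n}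
    (hw : ¬ Admissible w lam) : wordProd u w * wordProd u (coxeterWord n lam) = 0 := by
  induction w with
  | nil => exact absurd trivial hw
  | cons i w ih =>
    rw [wordProd_cons, mul_assoc]
    by_cases hw' : Admissible w lam
    · have hi : ¬ Movable i (run w lam) := fun hi => hw ⟨hw', hi⟩
      rw [h.wordProd_mul_coxeterWord, ← mul_assoc,
        h.mul_wordProd_eq_zero (isCoxeterWord_coxeterWord _) (by rwa [contour_coxeterWord]),
        zero_mul]
    · rw [ih hw', mul_zero]

theorem Satisfies.coxeterWord_mul_self (h : Satisfies u) (lam : Weight n) :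
    wordProd u (coxeterWord n lam) * wordProd u (coxeterWord n lam) =
      qSum u * wordProd u (coxeterWord n lam) := by
  rw [qSum, Finset.sum_mul]
  symm
  refine Finset.sum_eq_single lam (fun mu _ hmu => ?_) fun hl => absurd (Finset.mem_univ lam) hl
  refine h.wordProd_mul_coxeterWord_eq_zero ?_
  rw [(isCoxeterWord_coxeterWord mu).admissible_iff, contour_coxeterWord]
  exact hmu.symm

end Relations

/-! ### The representation on the configurations -/

section Representation

variable {n : ℕ} {R : Type*} [CommRing R]

/-- The matrix of the word `w` in the representation on the free module on the configurations: an
admissible word sends `lam` to the configuration that it reaches, multiplied by `t` for every time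
that a particle leaves the segment at its right end, and a word that is not admissible sends `lam`
to `0`. -/
noncomputable def wordMatrix (t : R) (w : List (Fin (n + 1))) : Matrix (Weight n) (Weight n) R :=
  open Classical in
  Matrix.of fun mu lam =>
    if Admissible w lam ∧ run w lam = mu then t ^ w.count (Fin.last n) else 0

theorem wordMatrix_nil (t : R) : wordMatrix t ([] : List (Fin (n + 1))) = 1 := by
  ext mu lam
  simp [wordMatrix, Matrix.one_apply, eq_comm]

theorem wordMatrix_cons (t : R) (i : Fin (n + 1)) (w : List (Fin (n + 1))) :
    wordMatrix t (i :: w) = wordMatrix t [i] * wordMatrix t w := by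
  classical
  ext mu lam
  rw [Matrix.mul_apply, Finset.sum_eq_single (run w lam)]
  · simp only [wordMatrix, Matrix.of_apply, admissible_cons, admissible_nil, run_cons, run_nil,
      true_and, and_true]
    by_cases h1 : Admissible w lam <;> by_cases h2 : Movable i (run w lam) <;>
      by_cases h3 : flip i (run w lam) = mu <;> simp [h1, h2, h3, List.count_cons, pow_add, mul_comm]
  · intro nu _ hnu
    simp [wordMatrix, hnu.symm]
  · intro h
    exact absurd (Finset.mem_univ _) h

theorem wordProd_wordMatrix (t : R) (w : List (Fin (n + 1))) :
    wordProd (fun i => wordMatrix t [i]) w = wordMatrix t w := by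
  induction w with
  | nil => simp [wordProd, wordMatrix_nil]
  | cons i w ih => rw [wordProd_cons, ih, ← wordMatrix_cons]

theorem wordMatrix_eq_zero (t : R) {w : List (Fin (n + 1))} (hw : ∀ lam, ¬ Admissible w lam) :
    wordMatrix t w = 0 := by
  ext mu lam
  simp [wordMatrix, hw lam]

theorem wordMatrix_eq_single (t : R) {w : List (Fin (n + 1))} (hw : IsCoxeterWord w) :
    wordMatrix t w = Matrix.single (contour w) (contour w) t := by
  ext mu lam
  simp only [wordMatrix, Matrix.of_apply, Matrix.single_apply, hw.admissible_iff, hw.count, pow_one]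
  refine if_congr ?_ rfl rfl
  constructor
  · rintro ⟨rfl, rfl⟩
    exact ⟨hw.run.symm, rfl⟩
  · rintro ⟨rfl, rfl⟩
    exact ⟨rfl, hw.run⟩

theorem not_admissible_sq (hn : 1 ≤ n) (i : Fin (n + 1)) (lam : Weight n) :
    ¬ Admissible [i, i] lam := by
  have : ∃ s : Fin n, s.castSucc = i ∨ s.succ = i := by
    have := i.isLt
    by_cases h : i.val = 0
    · exact ⟨⟨0, by omega⟩, Or.inl (by ext; simp [h])⟩
    · exact ⟨⟨i.val - 1, by omega⟩, Or.inr (by ext; simp; omega)⟩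
  obtain ⟨s, hs⟩ := this
  rintro ⟨⟨-, h1⟩, h2⟩
  have h1 := h1 s
  have h2 := h2 s
  simp only [run_cons, run_nil, flip] at h1 h2
  grind

/-- The site next to an inner generator `i` that is not next to its neighbour `j` blocks the second
of the two moves `i`. -/
theorem not_admissible_braid {i j : Fin (n + 1)} (hij : i ≠ j) (hi : 1 ≤ i.val)
    (hi' : i.val + 1 ≤ n) (lam : Weight n) : ¬ Admissible [i, j, i] lam := by
  have : ∃ s : Fin n, (s.castSucc = i ∨ s.succ = i) ∧ s.castSucc ≠ j ∧ s.succ ≠ j := by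
    by_cases h : i.val < j.val
    · exact ⟨⟨i.val - 1, by omega⟩, Or.inr (by ext; simp; omega),
        by simp [Fin.ext_iff]; omega, by simp [Fin.ext_iff]; omega⟩
    · exact ⟨⟨i.val, by omega⟩, Or.inl (by ext; simp),
        by simpa [Fin.ext_iff] using hij, by simp [Fin.ext_iff] at *; omega⟩
  obtain ⟨s, hs, hs1, hs2⟩ := this
  rintro ⟨⟨⟨-, h1⟩, -⟩, h3⟩
  have h1 := h1 s
  have h3 := h3 s
  simp only [run_cons, run_nil, flip] at h1 h3
  grind

theorem satisfies_wordMatrix (hn : 2 ≤ n) (t : R) :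
    Satisfies fun i : Fin (n + 1) => wordMatrix t [i] := by
  have h2 : ∀ i j : Fin (n + 1), wordMatrix t [i] * wordMatrix t [j] = wordMatrix t [i, j] :=
    fun i j => (wordMatrix_cons t i [j]).symm
  have h3 : ∀ i j l : Fin (n + 1),
      wordMatrix t [i] * wordMatrix t [j] * wordMatrix t [l] = wordMatrix t [i, j, l] :=
    fun i j l => by rw [mul_assoc, h2, ← wordMatrix_cons]
  intro x y hxy
  cases hxy with
  | sq i => rw [h2, wordMatrix_eq_zero t (not_admissible_sq (by omega) i)]
  | comm i j hij =>
    have hadm : ∀ lam, Admissible [i, j] lam ↔ Admissible [j, i] lam := fun lam =>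
      ⟨admissible_swap (Distant.symm hij), admissible_swap hij⟩
    have hp : List.Perm [i, j] [j, i] := List.Perm.swap j i []
    rw [h2, h2]
    ext mu lam
    have e : Admissible [i, j] lam ∧ run [i, j] lam = mu ↔
        Admissible [j, i] lam ∧ run [j, i] lam = mu := by
      rw [run_perm hp, hadm lam]
    simp only [wordMatrix, Matrix.of_apply, hp.count_eq]
    by_cases hc : Admissible [i, j] lam ∧ run [i, j] lam = mu
    · rw [if_pos hc, if_pos (e.1 hc)]
    · rw [if_neg hc, if_neg (mt e.2 hc)]
  | braid i j hij a b c d =>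
    rw [h3, wordMatrix_eq_zero t (not_admissible_braid (by rintro rfl; omega) a b)]
  | left i j a b =>
    rw [h3, wordMatrix_eq_zero t
      (not_admissible_braid (by rintro rfl; omega) (by omega) (by omega))]
  | right i j a b =>
    rw [h3, wordMatrix_eq_zero t
      (not_admissible_braid (by rintro rfl; omega) (by omega) (by omega))]

theorem qSum_wordMatrix (t : R) :
    qSum (fun i : Fin (n + 1) => wordMatrix t [i]) = t • (1 : Matrix (Weight n) (Weight n) R) := by
  have h : ∀ lam : Weight n, wordProd (fun i : Fin (n + 1) => wordMatrix t [i]) (coxeterWord n lam) =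
      Matrix.single lam lam t := fun lam => by
    rw [wordProd_wordMatrix, wordMatrix_eq_single t (isCoxeterWord_coxeterWord lam),
      contour_coxeterWord]
  rw [qSum, Finset.sum_congr rfl fun lam _ => h lam]
  rw [Matrix.smul_one_eq_diagonal, Matrix.sum_single_eq_diagonal]

/-! ### Connectedness -/

/-- The configuration `mu` can be reached from `lam` by allowed moves. -/
def Reachable (lam mu : Weight n) : Prop :=
  ∃ w : List (Fin (n + 1)), Admissible w lam ∧ run w lam = mu

theorem Reachable.refl (lam : Weight n) : Reachable lam lam :=
  ⟨[], trivial, rfl⟩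

theorem Reachable.trans {lam mu nu : Weight n} (h1 : Reachable lam mu) (h2 : Reachable mu nu) :
    Reachable lam nu := by
  obtain ⟨v, hv, rfl⟩ := h1
  obtain ⟨w, hw, rfl⟩ := h2
  exact ⟨w ++ v, (admissible_append _ _ _).2 ⟨hv, hw⟩, run_append _ _ _⟩

theorem Movable.reachable {i : Fin (n + 1)} {lam : Weight n} (h : Movable i lam) :
    Reachable lam (flip i lam) :=
  ⟨[i], ⟨trivial, h⟩, rfl⟩

/-- A move can be undone by further moves: the Coxeter word of the resulting configuration leads back
to it, and can be rearranged to end with that same move. -/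
theorem Movable.reachable_symm {i : Fin (n + 1)} {lam : Weight n} (h : Movable i lam) :
    Reachable (flip i lam) lam := by
  have hw := isCoxeterWord_coxeterWord (flip i lam)
  have h1 := hw.admissible
  have h2 := hw.run
  rw [contour_coxeterWord] at h1 h2
  obtain ⟨a, b, e, hia⟩ := List.eq_append_cons_of_mem (hw.2 i)
  rw [e] at h1 h2
  -- Only admissibility matters here, so the values are taken in a constant commuting family.
  have h3 := (admissible_pull (u := fun _ => (1 : ℕ)) (fun _ _ _ => rfl) i a b _ hia h1
    (by rwa [h2, flip_flip])).1
  refine ⟨a ++ b, h3.1, ?_⟩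
  rw [← flip_flip i (run (a ++ b) (flip i lam)), ← run_cons, run_perm List.perm_middle.symm, h2,
    flip_flip]

theorem Reachable.symm {lam mu : Weight n} (h : Reachable lam mu) : Reachable mu lam := by
  obtain ⟨w, hw, rfl⟩ := h
  induction w with
  | nil => exact Reachable.refl _
  | cons i w ih => exact hw.2.reachable_symm.trans (ih hw.1)

/-- Configurations that agree from the site `m` on can be reached from each other; a particle is
brought to the last site before `m` in order to create one at the site `m`. -/
theorem reachable_of_agree (m : ℕ) (hm : m ≤ n) (lam mu : Weight n)
    (h : ∀ s : Fin n, m ≤ s.val → lam s = mu s) : Reachable lam mu := by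
  induction m generalizing lam mu with
  | zero =>
    obtain rfl : lam = mu := funext fun s => h s (Nat.zero_le _)
    exact Reachable.refl _
  | succ m ih =>
    let s₀ : Fin n := ⟨m, hm⟩
    have key : ∀ lam mu : Weight n, (∀ s : Fin n, m + 1 ≤ s.val → lam s = mu s) →
        lam s₀ = true → mu s₀ = false → Reachable lam mu := by
      intro lam mu h h1 h2
      let nu : Weight n := fun s => if s.val + 1 = m then false else lam s
      have hnu : Movable s₀.castSucc nu := by
        refine fun s => ⟨fun hs => ?_, fun hs => ?_⟩
        · simp only [Fin.ext_iff, Fin.val_succ, Fin.val_castSucc, s₀] at hs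
          simp [nu, hs]
        · obtain rfl : s = s₀ := Fin.castSucc_injective n hs
          simp [nu, s₀] at h1 ⊢
          exact h1
      have e1 : Reachable lam nu := ih (by omega) _ _ fun s hs => by
        simp only [nu]
        rw [if_neg (by omega)]
      refine (e1.trans hnu.reachable).trans (ih (by omega) _ _ fun s hs => ?_)
      simp only [flip, nu, Fin.ext_iff, Fin.val_succ, Fin.val_castSucc]
      by_cases hsm : s = s₀
      · subst hsm
        have hne : ¬ s₀.val + 1 = m := by simp [s₀]
        simp [h1, h2, hne]
      · have hsm' : s.val ≠ m := fun e => hsm (Fin.ext e)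
        rw [if_neg (by simp only [s₀]; omega), if_neg (by omega), h s (by omega)]
    by_cases hs : lam s₀ = mu s₀
    · refine ih (by omega) _ _ fun s hsm => ?_
      rcases hsm.eq_or_lt with e | e
      · obtain rfl : s₀ = s := Fin.ext e
        exact hs
      · exact h s e
    · cases h1 : lam s₀ with
      | true => exact key _ _ h h1 (by simpa [h1] using Ne.symm hs)
      | false => exact (key _ _ (fun s hs => (h s hs).symm) (by simpa [h1] using Ne.symm hs) h1).symm

theorem reachable (lam mu : Weight n) : Reachable lam mu :=
  reachable_of_agree n le_rfl lam mu fun s hs => absurd s.isLt (by omega)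

/-! ### Paths with the same ends -/

/-- The number of particles at the site `s`, `0` or `1`. -/
def occupation (lam : Weight n) (s : Fin n) : ℕ := if lam s then 0 else 1

/-- Conservation of particles: a particle comes to the site `s` by each of the moves before it and
leaves it by each of the moves after it. -/
theorem occupation_run {w : List (Fin (n + 1))} {lam : Weight n} (hw : Admissible w lam)
    (s : Fin n) : occupation (run w lam) s + w.count s.succ =
      occupation lam s + w.count s.castSucc := by
  induction w with
  | nil => simp
  | cons i w ih =>
    have ih := ih hw.1
    have hm := hw.2 s
    have hs : s.castSucc ≠ s.succ := Fin.castSucc_lt_succ.ne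
    simp only [run_cons, List.count_cons, beq_iff_eq, occupation, flip] at ih ⊢
    grind

/-- Along two paths with the same ends, the multiplicities of any two letters differ in the same
way. -/
theorem count_add_count {v w : List (Fin (n + 1))} {lam : Weight n} (hv : Admissible v lam)
    (hw : Admissible w lam) (h : run v lam = run w lam) (i : Fin (n + 1)) :
    v.count i + w.count (Fin.last n) = w.count i + v.count (Fin.last n) := by
  induction i using Fin.reverseInduction with
  | last => exact add_comm _ _
  | cast s ih =>
    have h1 := occupation_run hv s
    have h2 := occupation_run hw s
    rw [h] at h1
    omega

end Representation

/-! ### Algebras in which `Q` is an invertible scalar -/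

section Bijective

variable {n : ℕ} {R A : Type*} [CommRing R] [Ring A] [Algebra R A]

/-- The idempotent `e_lam = Q⁻¹ u_lam` of an algebra in which `Q` is the invertible scalar `t`. -/
noncomputable def idem (t : Rˣ) (u : Fin (n + 1) → A) (lam : Weight n) : A :=
  (↑t⁻¹ : R) • wordProd u (coxeterWord n lam)

variable {t : Rˣ} {u : Fin (n + 1) → A}

theorem coxeterWord_mul_idem (h : Satisfies u) (hQ : qSum u = algebraMap R A t) (lam : Weight n) :
    wordProd u (coxeterWord n lam) * idem t u lam = (t : R) • idem t u lam := by
  rw [idem, mul_smul_comm, h.coxeterWord_mul_self, hQ, ← Algebra.smul_def, smul_comm]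

theorem sum_idem (hQ : qSum u = algebraMap R A t) : ∑ lam, idem t u lam = 1 := by
  have : ∑ lam, wordProd u (coxeterWord n lam) = algebraMap R A t := hQ
  simp only [idem]
  rw [← Finset.smul_sum, this, Algebra.algebraMap_eq_smul_one, smul_smul]
  simp

theorem wordProd_mul_idem_eq_zero (h : Satisfies u) {w : List (Fin (n + 1))} {lam : Weight n}
    (hw : ¬ Admissible w lam) : wordProd u w * idem t u lam = 0 := by
  rw [idem, mul_smul_comm, h.wordProd_mul_coxeterWord_eq_zero hw, smul_zero]

/-- An admissible word can be extended by `m` rounds along the Coxeter word of the starting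
configuration, which are made first; this multiplies its value on `e_lam` by `Q ^ m`. -/
theorem exists_append_rounds (h : Satisfies u) (hQ : qSum u = algebraMap R A t) {lam : Weight n}
    {w : List (Fin (n + 1))} (hw : Admissible w lam) (m : ℕ) :
    ∃ v : List (Fin (n + 1)), Admissible v lam ∧ (∀ i, v.count i = w.count i + m) ∧
      wordProd u v * idem t u lam = (t : R) ^ m • (wordProd u w * idem t u lam) := by
  induction m with
  | zero => exact ⟨w, hw, fun i => rfl, by simp⟩
  | succ m ih =>
    obtain ⟨v, hv, hc, he⟩ := ih
    have hcox := isCoxeterWord_coxeterWord lam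
    have h1 := hcox.admissible
    have h2 := hcox.run
    rw [contour_coxeterWord] at h1 h2
    refine ⟨v ++ coxeterWord n lam, ?_, fun i => ?_, ?_⟩
    · rw [admissible_append, h2]
      exact ⟨h1, hv⟩
    · rw [List.count_append, hc, hcox.count, add_assoc]
    · rw [wordProd_append, mul_assoc, coxeterWord_mul_idem h hQ, mul_smul_comm, he, smul_smul,
        pow_succ']

/-- Two paths from `lam` with the same end agree on `e_lam` up to a power of `Q`: they become
rearrangements of each other when each of them is extended by as many rounds as the other one
passes the right end. -/
theorem wordProd_mul_idem_eq (h : Satisfies u) (hQ : qSum u = algebraMap R A t) {lam : Weight n}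
    {v w : List (Fin (n + 1))} (hv : Admissible v lam) (hw : Admissible w lam)
    (hvw : run v lam = run w lam) :
    (t : R) ^ v.count (Fin.last n) • (wordProd u w * idem t u lam) =
      (t : R) ^ w.count (Fin.last n) • (wordProd u v * idem t u lam) := by
  obtain ⟨w', hw', hcw, hew⟩ := exists_append_rounds h hQ hw (v.count (Fin.last n))
  obtain ⟨v', hv', hcv, hev⟩ := exists_append_rounds h hQ hv (w.count (Fin.last n))
  rw [← hew, ← hev]
  congr 1
  refine wordProd_eq_of_perm h.comm (List.perm_iff_count.2 fun i => ?_) hw' hv'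
  rw [hcw, hcv, count_add_count hw hv hvw.symm]

theorem span_wordProd_mul_idem (hQ : qSum u = algebraMap R A t)
    (hgen : Algebra.adjoin R (Set.range u) = ⊤) :
    Submodule.span R (Set.range fun p : List (Fin (n + 1)) × Weight n =>
      wordProd u p.1 * idem t u p.2) = ⊤ := by
  set N := Submodule.span R (Set.range fun p : List (Fin (n + 1)) × Weight n =>
    wordProd u p.1 * idem t u p.2) with hN
  have hmul : ∀ x ∈ Algebra.adjoin R (Set.range u), ∀ y ∈ N, x * y ∈ N := by
    intro x hx
    induction hx using Algebra.adjoin_induction with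
    | mem x hx =>
      obtain ⟨i, rfl⟩ := hx
      intro y hy
      induction hy using Submodule.span_induction with
      | mem y hy =>
        obtain ⟨⟨w, lam⟩, rfl⟩ := hy
        refine Submodule.subset_span ⟨(i :: w, lam), ?_⟩
        simp only [wordProd_cons, mul_assoc]
      | zero => simp
      | add y z _ _ hy hz => rw [mul_add]; exact N.add_mem hy hz
      | smul r y _ hy => rw [mul_smul_comm]; exact N.smul_mem r hy
    | algebraMap r => intro y hy; rw [← Algebra.smul_def]; exact N.smul_mem r hy
    | add x y _ _ hx hy => intro z hz; rw [add_mul]; exact N.add_mem (hx z hz) (hy z hz)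
    | mul x y _ _ hx hy => intro z hz; rw [mul_assoc]; exact hx _ (hy z hz)
  have hone : (1 : A) ∈ N := by
    rw [← sum_idem hQ]
    refine N.sum_mem fun lam _ => Submodule.subset_span ⟨([], lam), ?_⟩
    simp [wordProd]
  refine Submodule.eq_top_iff'.2 fun x => ?_
  simpa using hmul x (hgen ▸ Algebra.mem_top) 1 hone

theorem map_wordProd_mul_idem {ρ : A →ₐ[R] Matrix (Weight n) (Weight n) R}
    (hρ : ∀ i, ρ (u i) = wordMatrix (t : R) [i]) {lam : Weight n} {w : List (Fin (n + 1))}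
    (hw : Admissible w lam) : ρ (wordProd u w * idem t u lam) =
      (t : R) ^ w.count (Fin.last n) • Matrix.single (run w lam) lam 1 := by
  have hword : ∀ w, ρ (wordProd u w) = wordMatrix (t : R) w := fun w => by
    rw [map_wordProd, ← wordProd_wordMatrix]
    simp only [hρ]
  rw [idem, mul_smul_comm, map_smul, map_mul, hword, hword,
    wordMatrix_eq_single _ (isCoxeterWord_coxeterWord lam), contour_coxeterWord,
    ← mul_smul_comm, Matrix.smul_single, smul_eq_mul, Units.inv_mul]
  ext mu nu
  rw [Matrix.smul_apply]
  by_cases hnu : nu = lam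
  · subst hnu
    rw [Matrix.mul_single_apply_same]
    by_cases hmu : run w nu = mu <;> simp [wordMatrix, hw, hmu]
  · rw [Matrix.mul_single_apply_of_ne _ _ _ _ _ hnu, Matrix.single_apply_of_col_ne _ _ (Ne.symm hnu),
      smul_zero]

/-- An algebra generated by elements that satisfy the relations, in which `Q` is an invertible
scalar, is a matrix algebra: for every pair of configurations choose a path from one to the other;
the corresponding elements span the algebra and go to multiples of the matrix units. -/
theorem bijective_of_map_eq_wordMatrix (h : Satisfies u) (hQ : qSum u = algebraMap R A t)
    (hgen : Algebra.adjoin R (Set.range u) = ⊤) {ρ : A →ₐ[R] Matrix (Weight n) (Weight n) R}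
    (hρ : ∀ i, ρ (u i) = wordMatrix (t : R) [i]) : Function.Bijective ρ := by
  choose p hp hp' using fun q : Weight n × Weight n => reachable q.2 q.1
  let σ : Matrix (Weight n) (Weight n) R →ₗ[R] A :=
    (Matrix.stdBasis R (Weight n) (Weight n)).constr R fun q =>
      (↑t⁻¹ : R) ^ (p q).count (Fin.last n) • (wordProd u (p q) * idem t u q.2)
  have hσ : ∀ mu lam : Weight n, σ (Matrix.single mu lam 1) =
      (↑t⁻¹ : R) ^ (p (mu, lam)).count (Fin.last n) •
        (wordProd u (p (mu, lam)) * idem t u lam) := fun mu lam => by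
    rw [← Matrix.stdBasis_eq_single]
    exact (Matrix.stdBasis R (Weight n) (Weight n)).constr_basis R _ _
  have hcancel : ∀ m : ℕ, (↑t⁻¹ : R) ^ m * (t : R) ^ m = 1 := fun m => by
    rw [← mul_pow, Units.inv_mul, one_pow]
  have h1 : ρ.toLinearMap ∘ₗ σ = LinearMap.id := by
    refine (Matrix.stdBasis R (Weight n) (Weight n)).ext fun q => ?_
    obtain ⟨mu, lam⟩ := q
    rw [Matrix.stdBasis_eq_single, LinearMap.comp_apply, hσ, map_smul, AlgHom.toLinearMap_apply,
      map_wordProd_mul_idem hρ (hp (mu, lam)), smul_smul, hcancel, one_smul, hp',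
      LinearMap.id_apply]
  have h2 : σ ∘ₗ ρ.toLinearMap = LinearMap.id := by
    refine LinearMap.ext_on_range (span_wordProd_mul_idem hQ hgen) fun q => ?_
    obtain ⟨w, lam⟩ := q
    rw [LinearMap.comp_apply, AlgHom.toLinearMap_apply, LinearMap.id_apply]
    dsimp only
    by_cases hw : Admissible w lam
    · rw [map_wordProd_mul_idem hρ hw, map_smul, hσ, smul_comm,
        ← wordProd_mul_idem_eq h hQ (hp _) hw (hp' _), smul_smul, hcancel, one_smul]
    · rw [wordProd_mul_idem_eq_zero h hw, map_zero, map_zero]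
  exact Function.bijective_iff_has_inverse.2
    ⟨σ, fun x => LinearMap.congr_fun h2 x, fun x => LinearMap.congr_fun h1 x⟩

end Bijective

/-! ### Centrality of `Q` and the localization -/

section Main

open LaurentPolynomial

variable (k : Type*) [Field k] (n : ℕ)

theorem satisfies_u : Satisfies (NTL.u k n) :=
  (satisfies_map_iff (RingQuot.mkAlgHom k (Rel (n := n) (FreeAlgebra.ι k))).toRingHom
    (FreeAlgebra.ι k)).2 fun _ _ hxy => RingQuot.mkAlgHom_rel k hxy

theorem satisfies_loc_u : Satisfies (NTLLoc.u k n) :=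
  (satisfies_map_iff (RingQuot.mkAlgHom k (LocRel k n)).toRingHom fun i =>
    FreeAlgebra.ι k (some i)).2 fun x y hxy => RingQuot.mkAlgHom_rel k (LocRel.base x y hxy)

theorem toLoc_Q : toLoc k n (NTL.Q k n) = qSum (NTLLoc.u k n) := by
  rw [NTL.Q, map_qSum]
  simp only [toLoc_u]

/-- An element of `T(n)` that commutes with the generators is central. -/
theorem commute_of_forall_u {z : NTL k n} (hz : ∀ i, Commute z (NTL.u k n i)) (x : NTL k n) :
    Commute z x := by
  obtain ⟨x, rfl⟩ := RingQuot.mkAlgHom_surjective k _ x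
  induction x using FreeAlgebra.induction with
  | grade0 r => rw [AlgHom.commutes]; exact Algebra.commute_algebraMap_right r z
  | grade1 i => exact hz i
  | mul x y hx hy => rw [map_mul]; exact hx.mul_right hy
  | add x y hx hy => rw [map_add]; exact hx.add_right hy

theorem commute_Q (x : NTL k n) : Commute (NTL.Q k n) x :=
  commute_of_forall_u k n (fun i => ((satisfies_u k n).mul_qSum i).symm) x

theorem commute_qUnit (x : NTLLoc k n) : Commute (qUnit k n : NTLLoc k n) x := by
  obtain ⟨x, rfl⟩ := RingQuot.mkAlgHom_surjective k _ x
  induction x using FreeAlgebra.induction with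
  | grade0 r => rw [AlgHom.commutes]; exact Algebra.commute_algebraMap_right r _
  | grade1 i =>
    cases i with
    | none => exact (Commute.refl (qUnit k n : NTLLoc k n)).units_inv_right
    | some i =>
      have h := ((satisfies_loc_u k n).mul_qSum i).symm
      rw [← toLoc_Q] at h
      exact h
  | mul x y hx hy => rw [map_mul]; exact hx.mul_right hy
  | add x y hx hy => rw [map_add]; exact hx.add_right hy

theorem commute_scalarHom (p : k[T;T⁻¹]) (x : NTLLoc k n) : Commute (scalarHom k n p) x := by
  induction p using AddMonoidAlgebra.induction_linear with
  | zero => rw [map_zero]; exact Commute.zero_left x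
  | add p q hp hq => rw [map_add]; exact hp.add_left hq
  | single m r =>
    rw [scalarHom, AddMonoidAlgebra.lift_single]
    refine Commute.smul_left ?_ r
    exact (commute_qUnit k n x).units_zpow_left m

/-- The Laurent polynomial `q` as a unit. -/
noncomputable def laurentUnit : (k[T;T⁻¹])ˣ where
  val := T 1
  inv := T (-1)
  val_inv := by rw [← T_add]; simp
  inv_val := by rw [← T_add]; simp

/-- The images of the generators `u_0, …, u_n` (as `some i`) and `Q⁻¹` (as `none`) in the matrix
ring. -/
noncomputable def genMatrix :
    Option (Fin (n + 1)) → Matrix (Weight n) (Weight n) k[T;T⁻¹]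
  | some i => wordMatrix (T 1) [i]
  | none => (T (-1) : k[T;T⁻¹]) • 1

/-- The representation of `T(n)[Q⁻¹]` by matrices over the Laurent polynomials. -/
noncomputable def locMatrix (hn : 2 ≤ n) :
    NTLLoc k n →ₐ[k] Matrix (Weight n) (Weight n) k[T;T⁻¹] :=
  RingQuot.liftAlgHom k ⟨FreeAlgebra.lift k (genMatrix k n), fun x y hxy => by
    have hsome : (fun i : Fin (n + 1) => FreeAlgebra.lift k (genMatrix k n)
        (FreeAlgebra.ι k (some i))) = fun i => wordMatrix (T 1 : k[T;T⁻¹]) [i] := by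
      funext i
      rw [FreeAlgebra.lift_ι_apply, genMatrix]
    have hq : FreeAlgebra.lift k (genMatrix k n)
        (qSum fun i : Fin (n + 1) => FreeAlgebra.ι k (some i)) = (T 1 : k[T;T⁻¹]) • 1 := by
      rw [map_qSum, hsome, qSum_wordMatrix]
    have hi : FreeAlgebra.lift k (genMatrix k n) (FreeAlgebra.ι k none) =
        (T (-1) : k[T;T⁻¹]) • 1 := by
      rw [FreeAlgebra.lift_ι_apply, genMatrix]
    cases hxy with
    | base x y h =>
      refine (satisfies_map_iff (FreeAlgebra.lift k (genMatrix k n)).toRingHom _).1 ?_ x y h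
      have := satisfies_wordMatrix hn (T 1 : k[T;T⁻¹])
      rw [← hsome] at this
      exact this
    | mul_inv =>
      rw [map_mul, hq, hi, map_one, smul_mul_smul_comm, ← T_add]
      simp
    | inv_mul =>
      rw [map_mul, hq, hi, map_one, smul_mul_smul_comm, ← T_add]
      simp⟩

theorem locMatrix_u (hn : 2 ≤ n) (i : Fin (n + 1)) :
    locMatrix k n hn (NTLLoc.u k n i) = wordMatrix (T 1) [i] := by
  simp [locMatrix, NTLLoc.u, genMatrix]

theorem locMatrix_Q (hn : 2 ≤ n) :
    locMatrix k n hn (toLoc k n (NTL.Q k n)) = (T 1 : k[T;T⁻¹]) • 1 := by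
  rw [toLoc_Q, map_qSum]
  simp only [locMatrix_u]
  exact qSum_wordMatrix _

theorem locMatrix_wordProd (hn : 2 ≤ n) {w : List (Fin (n + 1))} (hw : IsCoxeterWord w) :
    locMatrix k n hn (toLoc k n (wordProd (NTL.u k n) w)) =
      Matrix.single (contour w) (contour w) (T 1) := by
  rw [map_wordProd, map_wordProd]
  simp only [toLoc_u, locMatrix_u]
  rw [wordProd_wordMatrix, wordMatrix_eq_single _ hw]

theorem locMatrix_scalarHom (hn : 2 ≤ n) (p : k[T;T⁻¹]) :
    locMatrix k n hn (scalarHom k n p) =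
      algebraMap k[T;T⁻¹] (Matrix (Weight n) (Weight n) k[T;T⁻¹]) p := by
  have h : (locMatrix k n hn).comp (scalarHom k n) =
      IsScalarTower.toAlgHom k k[T;T⁻¹] (Matrix (Weight n) (Weight n) k[T;T⁻¹]) := by
    refine AddMonoidAlgebra.algHom_ext' (MonoidHom.ext_mint ?_)
      (Subsingleton.elim _ _)
    change locMatrix k n hn (scalarHom k n (T 1)) =
      algebraMap k[T;T⁻¹] (Matrix (Weight n) (Weight n) k[T;T⁻¹]) (T 1)
    rw [scalarHom_T, locMatrix_Q, Algebra.algebraMap_eq_smul_one]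
  exact DFunLike.congr_fun h p

theorem adjoin_loc_u (hc : ∀ (p : k[T;T⁻¹]) (x : NTLLoc k n),
      scalarHom k n p * x = x * scalarHom k n p) :
    letI : Algebra k[T;T⁻¹] (NTLLoc k n) := (scalarHom k n).toRingHom.toAlgebra' hc
    Algebra.adjoin k[T;T⁻¹] (Set.range (NTLLoc.u k n)) = ⊤ := by
  let _ : Algebra k[T;T⁻¹] (NTLLoc k n) := (scalarHom k n).toRingHom.toAlgebra' hc
  refine Algebra.eq_top_iff.2 fun x => ?_
  obtain ⟨x, rfl⟩ := RingQuot.mkAlgHom_surjective k _ x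
  induction x using FreeAlgebra.induction with
  | grade0 r =>
    have : RingQuot.mkAlgHom k (LocRel k n) (algebraMap k _ r) =
        scalarHom k n (algebraMap k _ r) := by
      rw [AlgHom.commutes, AlgHom.commutes]
    rw [this]
    exact Subalgebra.algebraMap_mem _ (algebraMap k k[T;T⁻¹] r)
  | grade1 i =>
    cases i with
    | none =>
      have : RingQuot.mkAlgHom k (LocRel k n) (FreeAlgebra.ι k none) = scalarHom k n (T (-1)) := by
        have h : (T (-1) : k[T;T⁻¹]) = AddMonoidAlgebra.single (-1) 1 := rfl
        rw [h, scalarHom, AddMonoidAlgebra.lift_single]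
        simp [qUnit]
      rw [this]
      exact Subalgebra.algebraMap_mem _ (T (-1) : k[T;T⁻¹])
    | some i => exact Algebra.subset_adjoin ⟨i, rfl⟩
  | mul x y hx hy => rw [map_mul]; exact mul_mem hx hy
  | add x y hx hy => rw [map_add]; exact add_mem hx hy

end Main

end NilTL

theorem theorem2p6 (k : Type*) [Field k] (n : ℕ) (hn : 2 ≤ n) :
    (∀ x : NilTL.NTL k n, Commute (NilTL.NTL.Q k n) x) ∧
    ∃ hc : ∀ (p : k[T;T⁻¹]) (x : NilTL.NTLLoc k n),
        NilTL.scalarHom k n p * x = x * NilTL.scalarHom k n p,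
      letI : Algebra k[T;T⁻¹] (NilTL.NTLLoc k n) :=
        (NilTL.scalarHom k n).toRingHom.toAlgebra' hc
      ∃ φ : NilTL.NTLLoc k n ≃ₐ[k[T;T⁻¹]]
          Matrix (NilTL.Weight n) (NilTL.Weight n) k[T;T⁻¹],
        φ (NilTL.toLoc k n (NilTL.NTL.Q k n)) =
          (LaurentPolynomial.T 1 : k[T;T⁻¹]) •
            (1 : Matrix (NilTL.Weight n) (NilTL.Weight n) k[T;T⁻¹]) ∧
        ∀ w : List (Fin (n + 1)), NilTL.IsCoxeterWord w →
          φ (NilTL.toLoc k n (NilTL.wordProd (NilTL.NTL.u k n) w)) =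
            Matrix.single (NilTL.contour w) (NilTL.contour w)
              (LaurentPolynomial.T 1 : k[T;T⁻¹]) := by
  have hc : ∀ (p : k[T;T⁻¹]) (x : NilTL.NTLLoc k n),
      NilTL.scalarHom k n p * x = x * NilTL.scalarHom k n p := NilTL.commute_scalarHom k n
  refine ⟨NilTL.commute_Q k n, hc, ?_⟩
  let _ : Algebra k[T;T⁻¹] (NilTL.NTLLoc k n) := (NilTL.scalarHom k n).toRingHom.toAlgebra' hc
  let ρ : NilTL.NTLLoc k n →ₐ[k[T;T⁻¹]]
      Matrix (NilTL.Weight n) (NilTL.Weight n) k[T;T⁻¹] :=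
    { (NilTL.locMatrix k n hn).toRingHom with
      commutes' := NilTL.locMatrix_scalarHom k n hn }
  have hQ : NilTL.qSum (NilTL.NTLLoc.u k n) =
      algebraMap k[T;T⁻¹] (NilTL.NTLLoc k n) (NilTL.laurentUnit k) :=
    (NilTL.toLoc_Q k n).symm.trans (NilTL.scalarHom_T k n).symm
  have hρ : Function.Bijective ρ :=
    NilTL.bijective_of_map_eq_wordMatrix (NilTL.satisfies_loc_u k n) hQ
      (NilTL.adjoin_loc_u k n hc) (NilTL.locMatrix_u k n hn)
  exact ⟨AlgEquiv.ofBijective ρ hρ, NilTL.locMatrix_Q k n hn,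
    fun w hw => NilTL.locMatrix_wordProd k n hn hw⟩
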